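/- Let $N\ge 1$ be an integer and let $\alpha>0$ with $N>2\alpha$; put $2_\alpha^*=\frac{2N}{N-2\alpha}$. All functions are real-valued, and functions that agree almost everywhere are identified. Let $$G_\alpha(x)=\frac{1}{(4\pi)^{\alpha/2}\Gamma(\alpha/2)}\int_0^\infty e^{-\pi|x|^2/t}\,e^{-t/(4\pi)}\,t^{\frac{\alpha-N}{2}-1}\,dt ,\qquad x\in\mathbb{R}^N\setminus\{0\},$$ be the Bessel kernel, and let $L^{\alpha,2}(\mathbb{R}^N)=\{G_\alpha\star g : g\in L^2(\mathbb{R}^N)\}$ be the Bessel space; for $u=G_\alpha\star g$ with $g\in L^2(\mathbb{R}^N)$ write $(I-\Delta)^{\alpha/2}u=g$. Let $V\colon\mathbb{R}^N\to\mathbb{R}$ be a (Lebesgue) measurable function such that (V1) $\operatorname{ess\,inf}_{x\in\mathbb{R}^N}V(x)>0$; (V2) $\displaystyle\lim_{|y|\to+\infty}\int_{B(y,1)}\frac{dx}{V(x)}=0$, where $B(y,1)=\{x\in\mathbb{R}^N : |x-y|<1\}$. Let $$H=\Big\{u\in L^{\alpha,2}(\mathbb{R}^N) : \int_{\mathbb{R}^N}V(x)|u(x)|^2\,dx<+\infty\Big\},\qquad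 \|u\|_H^2=\int_{\mathbb{R}^N}\big|(I-\Delta)^{\alpha/2}u\big|^2\,dx+\int_{\mathbb{R}^N}V(x)|u(x)|^2\,dx .$$ If $2\le q<2_\alpha^*$, then $H$ is compactly embedded into $L^q(\mathbb{R}^N)$; that is, $H\subset L^q(\mathbb{R}^N)$, there is a constant $C$ with $\|u\|_{L^q}\le C\|u\|_H$ for all $u\in H$, and every sequence that is bounded in $H$ has a subsequence that converges in $L^q(\mathbb{R}^N)$. -/

import Mathlib

open MeasureTheory Filter Topology
open scoped Convolution ENNReal

noncomputable section

/-- The Bessel convolution kernel `G_α` on `ℝ^N`. The integral converges for `x ≠ 0` and `α > 0`;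
the value at the single point `x = 0` is irrelevant. -/
def besselKernel {N : ℕ} (α : ℝ) (x : EuclideanSpace ℝ (Fin N)) : ℝ :=
  1 / ((4 * Real.pi) ^ (α / 2) * Real.Gamma (α / 2)) *
    ∫ t in Set.Ioi (0 : ℝ),
      Real.exp (-(Real.pi / t) * ‖x‖ ^ 2) * Real.exp (-(t / (4 * Real.pi))) *
        t ^ ((α - (N : ℝ)) / 2 - 1)

/-- The function `G_α ⋆ g`. -/
def besselConv {N : ℕ} (α : ℝ) (g : EuclideanSpace ℝ (Fin N) → ℝ) :
    EuclideanSpace ℝ (Fin N) → ℝ :=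
  besselKernel α ⋆[ContinuousLinearMap.mul ℝ ℝ, volume] g

/-- `u` belongs to the Bessel function space `L^{α,2}(ℝ^N)`: up to a null set `u = G_α ⋆ g` for
some `g ∈ L²(ℝ^N)`. -/
def MemBesselSpace {N : ℕ} (α : ℝ) (u : EuclideanSpace ℝ (Fin N) → ℝ) : Prop :=
  ∃ g : EuclideanSpace ℝ (Fin N) → ℝ, MemLp g 2 volume ∧ u =ᵐ[volume] besselConv α g

open Classical in
/-- The function `(I - Δ)^{α/2} u` for `u ∈ L^{α,2}(ℝ^N)`, that is, the `g ∈ L²(ℝ^N)` such that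
`u = G_α ⋆ g`. For `α > 0` this `g` is unique up to a null set, because the Fourier transform of
`G_α` vanishes nowhere, so that the choice is immaterial. (It is `0` outside the space.) -/
def besselOperator {N : ℕ} (α : ℝ) (u : EuclideanSpace ℝ (Fin N) → ℝ) :
    EuclideanSpace ℝ (Fin N) → ℝ :=
  if h : MemBesselSpace α u then h.choose else 0

/-- `V` is a coercive electric potential. -/
structure IsCoerciveElectricPotential {N : ℕ} (V : EuclideanSpace ℝ (Fin N) → ℝ) : Prop where
  essInf_pos : 0 < essInf (fun x => (V x : EReal)) volume
  tendsto_integral_inv :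
    Tendsto (fun y => ∫ x in Metric.ball y 1, 1 / V x)
      (Filter.cocompact (EuclideanSpace ℝ (Fin N))) (𝓝 0)

/-- The weighted space `H` of all `u ∈ L^{α,2}(ℝ^N)` with `∫ V |u|² < ∞`. Under the positivity
assumption on `V` the integrand is nonnegative almost everywhere, so that integrability means
exactly that the integral is finite. -/
def weightedSpace {N : ℕ} (α : ℝ) (V : EuclideanSpace ℝ (Fin N) → ℝ) :
    Set (EuclideanSpace ℝ (Fin N) → ℝ) :=
  {u | MemBesselSpace α u ∧ Integrable (fun x => V x * |u x| ^ 2) volume}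

/-- The norm of `H`. -/
def weightedNorm {N : ℕ} (α : ℝ) (V : EuclideanSpace ℝ (Fin N) → ℝ)
    (u : EuclideanSpace ℝ (Fin N) → ℝ) : ℝ :=
  Real.sqrt ((∫ x, |besselOperator α u x| ^ 2) + ∫ x, V x * |u x| ^ 2)

/-- A space `X` of functions on `ℝ^N` with norm `nrm` is compactly embedded into `L^q(ℝ^N)`: `X` is
contained in `L^q(ℝ^N)`, the inclusion is continuous, and every sequence that is bounded in `X` has
a subsequence that converges in `L^q(ℝ^N)`. -/
structure IsCompactlyEmbeddedInLp {N : ℕ} (X : Set (EuclideanSpace ℝ (Fin N) → ℝ))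
    (nrm : (EuclideanSpace ℝ (Fin N) → ℝ) → ℝ) (q : ℝ≥0∞) : Prop where
  memLp : ∀ u ∈ X, MemLp u q volume
  continuous : ∃ C : ℝ, ∀ u ∈ X, eLpNorm u q volume ≤ ENNReal.ofReal (C * nrm u)
  compact : ∀ u : ℕ → EuclideanSpace ℝ (Fin N) → ℝ, (∀ n, u n ∈ X) →
    (∃ M : ℝ, ∀ n, nrm (u n) ≤ M) →
    ∃ f : EuclideanSpace ℝ (Fin N) → ℝ, MemLp f q volume ∧
      ∃ φ : ℕ → ℕ, StrictMono φ ∧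
        Tendsto (fun k => eLpNorm (u (φ k) - f) q volume) atTop (𝓝 0)

end

/-! Let `u = G ⋆ g` with `G` the Bessel kernel and `g ∈ L²`, and let `r` satisfy `1/r + 1/2 = 1 +
1/q`. The condition `q < 2N/(N - 2α)` says exactly that `(N - α) r < N`, which puts `G` in `L^r`.
Young's inequality then gives `‖u‖_q ≤ ‖G‖_r ‖g‖₂`, which is the continuous embedding, and also
`‖u(· + h) - u‖_q ≤ ‖G(· + h) - G‖_r ‖g‖₂`, so that bounded sets of `H` are equicontinuous under
translation in `L^q`.

Compactness follows from a Kolmogorov–Riesz argument for averages over balls of radius `δ`. By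
equicontinuity the averages are uniformly close to the functions in `L^q`. Along a subsequence
converging weakly in `L²` they converge pointwise, with a uniform bound. Outside a large ball they
are small: by Cauchy–Schwarz with weight `V`, the squared average at `x` is at most `|B_δ|⁻²
∫_{B(x,1)} 1/V · ∫_{B(x,1)} V u²`, where the first integral tends to `0` by (V2); raising to the
power `q/2` and integrating in `x` gives the tail bound. Only the averages need small tails, so no
decay of `u` itself is required and `q = 2` is not a special case.

The main lemmas are `memLp_besselKernel`, `eLpNorm_convolution_translate_sub_le`,
`setLIntegral_setAverage_ball_rpow_le` and `exists_tendsto_eLpNorm_of_equicontinuous_of_tail`. -/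

/-! ### Young's inequality for nonnegative functions -/

/-- **Young's convolution inequality** for the lower Lebesgue integral. -/
theorem lintegral_convolution_rpow_le {E : Type*} [MeasurableSpace E] [AddGroup E]
    [MeasurableAdd₂ E] [MeasurableNeg E] {μ : Measure E} [SFinite μ] [μ.IsAddLeftInvariant]
    [μ.IsAddRightInvariant] [μ.IsNegInvariant]
    {f g : E → ℝ≥0∞} (hf : AEMeasurable f μ) (hg : AEMeasurable g μ) {p q r : ℝ}
    (hp : 0 < p) (hr : 0 < r) (hpq : p ≤ q) (hrq : r ≤ q) (h : 1 / p + 1 / r = 1 + 1 / q) :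
    ∫⁻ x, (∫⁻ t, f t * g (x - t) ∂μ) ^ q ∂μ ≤
      (∫⁻ x, f x ^ p ∂μ) ^ (q / p) * (∫⁻ x, g x ^ r ∂μ) ^ (q / r) := by
  have hq : 0 < q := hp.trans_le hpq
  have ha : 0 ≤ 1 / p - 1 / q := sub_nonneg.2 (one_div_le_one_div_of_le hp hpq)
  have hb : 0 ≤ 1 / r - 1 / q := sub_nonneg.2 (one_div_le_one_div_of_le hr hrq)
  have hgx (x : E) : AEMeasurable (fun t => g (x - t)) μ :=
    hg.comp_quasiMeasurePreserving (Measure.measurePreserving_sub_left μ x).quasiMeasurePreserving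
  have hpt (x : E) : (∫⁻ t, f t * g (x - t) ∂μ) ^ q ≤
      (∫⁻ t, f t ^ p * g (x - t) ^ r ∂μ) *
        ((∫⁻ t, f t ^ p ∂μ) ^ (q / p - 1) * (∫⁻ t, g t ^ r ∂μ) ^ (q / r - 1)) := by
    -- Three-factor Hölder: the exponents `1/q`, `1/p - 1/q`, `1/r - 1/q` sum to `1` by `h`, and the
    -- product of the three powers is `f t * g (x - t)`.
    have key := ENNReal.lintegral_prod_norm_pow_le (μ := μ) (Finset.univ : Finset (Fin 3))
      (f := ![fun t => f t ^ p * g (x - t) ^ r, fun t => f t ^ p, fun t => g (x - t) ^ r])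
      (p := ![1 / q, 1 / p - 1 / q, 1 / r - 1 / q])
      (by
        intro i _
        fin_cases i
        · exact (hf.pow_const p).mul ((hgx x).pow_const r)
        · exact hf.pow_const p
        · exact (hgx x).pow_const r)
      (by simp [Fin.sum_univ_three]; simp at h; linarith)
      (by
        intro i _
        fin_cases i
        · simpa using hq.le
        · simpa using ha
        · simpa using hb)
    simp only [Fin.prod_univ_three] at key
    change ∫⁻ t, (f t ^ p * g (x - t) ^ r) ^ (1 / q) * (f t ^ p) ^ (1 / p - 1 / q) *
        (g (x - t) ^ r) ^ (1 / r - 1 / q) ∂μ ≤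
      (∫⁻ t, f t ^ p * g (x - t) ^ r ∂μ) ^ (1 / q) * (∫⁻ t, f t ^ p ∂μ) ^ (1 / p - 1 / q) *
        (∫⁻ t, g (x - t) ^ r ∂μ) ^ (1 / r - 1 / q) at key
    have hint : ∀ t, (f t ^ p * g (x - t) ^ r) ^ (1 / q) * (f t ^ p) ^ (1 / p - 1 / q) *
        (g (x - t) ^ r) ^ (1 / r - 1 / q) = f t * g (x - t) := by
      intro t
      rw [ENNReal.mul_rpow_of_nonneg _ _ (by positivity)]
      simp only [← ENNReal.rpow_mul]
      rw [mul_right_comm (f t ^ _), mul_assoc, ← ENNReal.rpow_add_of_nonneg _ _ (by positivity)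
        (by positivity), ← ENNReal.rpow_add_of_nonneg _ _ (by positivity) (by positivity)]
      have e1 : p * (1 / q) + p * (1 / p - 1 / q) = 1 := by field_simp; ring
      have e2 : r * (1 / q) + r * (1 / r - 1 / q) = 1 := by field_simp; ring
      rw [e1, e2, ENNReal.rpow_one, ENNReal.rpow_one]
    simp only [hint] at key
    have hinv : ∫⁻ t, g (x - t) ^ r ∂μ = ∫⁻ t, g t ^ r ∂μ :=
      lintegral_sub_left_eq_self (μ := μ) (fun t => g t ^ r) x
    rw [hinv] at key
    refine (ENNReal.rpow_le_rpow key hq.le).trans_eq ?_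
    rw [ENNReal.mul_rpow_of_nonneg _ _ hq.le, ENNReal.mul_rpow_of_nonneg _ _ hq.le]
    simp only [← ENNReal.rpow_mul]
    have e0 : 1 / q * q = 1 := by field_simp
    have e1 : (1 / p - 1 / q) * q = q / p - 1 := by field_simp
    have e2 : (1 / r - 1 / q) * q = q / r - 1 := by field_simp
    rw [e0, e1, e2, ENNReal.rpow_one, mul_assoc]
  have hp1 : 0 ≤ q / p - 1 := sub_nonneg.2 ((one_le_div hp).2 hpq)
  have hr1 : 0 ≤ q / r - 1 := sub_nonneg.2 ((one_le_div hr).2 hrq)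
  have hmeas : AEMeasurable (fun z : E × E => f z.2 ^ p * g (z.1 - z.2) ^ r) (μ.prod μ) :=
    ((hf.comp_quasiMeasurePreserving Measure.quasiMeasurePreserving_snd).pow_const p).mul
      ((hg.comp_quasiMeasurePreserving
        (quasiMeasurePreserving_sub_of_right_invariant μ μ)).pow_const r)
  have htonelli : ∫⁻ x, ∫⁻ t, f t ^ p * g (x - t) ^ r ∂μ ∂μ =
      (∫⁻ x, f x ^ p ∂μ) * ∫⁻ x, g x ^ r ∂μ := by
    rw [lintegral_lintegral_swap hmeas, ← lintegral_mul_const'' _ (hf.pow_const p)]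
    refine lintegral_congr fun t => ?_
    rw [lintegral_const_mul'']
    · rw [lintegral_sub_right_eq_self (μ := μ) (fun x => g x ^ r) t]
    · exact (hg.comp_quasiMeasurePreserving
        (measurePreserving_sub_right μ t).quasiMeasurePreserving).pow_const r
  have hmeas' : AEMeasurable (fun x => ∫⁻ t, f t ^ p * g (x - t) ^ r ∂μ) μ :=
    hmeas.lintegral_prod_right'
  calc _ ≤ ∫⁻ x, (∫⁻ t, f t ^ p * g (x - t) ^ r ∂μ) *
        ((∫⁻ t, f t ^ p ∂μ) ^ (q / p - 1) * (∫⁻ t, g t ^ r ∂μ) ^ (q / r - 1)) ∂μ :=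
        lintegral_mono hpt
    _ = ((∫⁻ x, f x ^ p ∂μ) * (∫⁻ t, f t ^ p ∂μ) ^ (q / p - 1)) *
        ((∫⁻ x, g x ^ r ∂μ) * (∫⁻ t, g t ^ r ∂μ) ^ (q / r - 1)) := by
        rw [lintegral_mul_const'' _ hmeas', htonelli, mul_mul_mul_comm]
    _ = _ := by
        have aux (a : ℝ≥0∞) (s : ℝ) (hs : 0 ≤ s - 1) : a * a ^ (s - 1) = a ^ s := by
          nth_rewrite 1 [← ENNReal.rpow_one a]
          rw [← ENNReal.rpow_add_of_nonneg _ _ zero_le_one hs]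
          congr 1; ring
        rw [aux _ _ hp1, aux _ _ hr1]

/-! ### Size and integrability of the Bessel kernel -/

/-- Raise `y / s ≤ exp (y / s)` to the power `s` and invert. -/
theorem Real.exp_neg_le_rpow_neg {s y : ℝ} (hs : 0 < s) (hy : 0 < y) :
    Real.exp (-y) ≤ s ^ s * y ^ (-s) := by
  have h1 : y / s ≤ Real.exp (y / s) := by linarith [Real.add_one_le_exp (y / s)]
  have h2 : (y / s) ^ s ≤ Real.exp y := by
    refine (Real.rpow_le_rpow (by positivity) h1 hs.le).trans_eq ?_
    rw [← Real.exp_mul]; congr 1; field_simp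
  rw [Real.exp_neg, Real.rpow_neg hy.le, ← div_eq_mul_inv,
    inv_le_comm₀ (Real.exp_pos y) (by positivity), inv_div, ← Real.div_rpow hy.le hs.le]
  exact h2

theorem integrableOn_exp_mul_rpow {b s : ℝ} (hb : 0 < b) (hs : -1 < s) :
    IntegrableOn (fun t : ℝ => Real.exp (-(t / b)) * t ^ s) (Set.Ioi 0) := by
  have := integrableOn_rpow_mul_exp_neg_mul_rpow (p := 1) (s := s) (b := 1 / b) hs one_pos
    (by positivity)
  refine this.congr_fun (fun t _ => ?_) measurableSet_Ioi
  simp only [Real.rpow_one]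
  rw [mul_comm]; congr 2; ring

/-- Power bounds for the Bessel kernel. -/
theorem exists_norm_besselKernel_le {N : ℕ} {α a : ℝ} (ha : 0 < a) (h : (N : ℝ) - α < a) :
    ∃ C : ℝ, 0 ≤ C ∧ ∀ x : EuclideanSpace ℝ (Fin N), x ≠ 0 →
      ‖besselKernel α x‖ ≤ C * ‖x‖ ^ (-a) := by
  -- Bounding the Gaussian by a multiple of `(π‖x‖²/t)^(-s)` extracts `‖x‖^(-a)` and leaves a factor
  -- `t^s`; the remaining integral converges at `0` precisely because `a > N - α`.
  set s := a / 2 with hs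
  have hs0 : 0 < s := by positivity
  set I := ∫ t in Set.Ioi (0 : ℝ), Real.exp (-(t / (4 * Real.pi))) *
    t ^ (s + ((α - (N : ℝ)) / 2 - 1)) with hI
  have hI0 : 0 ≤ I := setIntegral_nonneg measurableSet_Ioi fun t ht => by
    have : (0 : ℝ) < t := ht
    positivity
  refine ⟨‖1 / ((4 * Real.pi) ^ (α / 2) * Real.Gamma (α / 2))‖ * (s ^ s * Real.pi ^ (-s) * I),
    by positivity, fun x hx => ?_⟩
  have hx0 : 0 < ‖x‖ := norm_pos_iff.2 hx
  rw [besselKernel, norm_mul, mul_assoc]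
  refine mul_le_mul_of_nonneg_left ?_ (norm_nonneg _)
  have hint := integrableOn_exp_mul_rpow (b := 4 * Real.pi) (s := s + ((α - (N : ℝ)) / 2 - 1))
    (by positivity) (by linarith)
  refine (norm_integral_le_of_norm_le (hint.const_mul (s ^ s * Real.pi ^ (-s) * ‖x‖ ^ (-a)))
    ?_).trans_eq ?_
  · refine ae_restrict_of_forall_mem measurableSet_Ioi fun t ht => ?_
    have ht0 : (0 : ℝ) < t := ht
    rw [Real.norm_of_nonneg (by positivity), Real.rpow_add ht0]
    have h1 := Real.exp_neg_le_rpow_neg hs0 (y := Real.pi / t * ‖x‖ ^ 2) (by positivity)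
    have h2 : (Real.pi / t * ‖x‖ ^ 2) ^ (-s) = Real.pi ^ (-s) * ‖x‖ ^ (-a) * t ^ s := by
      rw [Real.mul_rpow (by positivity) (by positivity),
        Real.div_rpow (by positivity) (by positivity), Real.rpow_neg ht0.le, div_inv_eq_mul,
        ← Real.rpow_natCast ‖x‖ 2, ← Real.rpow_mul hx0.le]
      have : ((2 : ℕ) : ℝ) * -s = -a := by rw [hs]; push_cast; ring
      rw [this]; ring
    rw [h2] at h1
    rw [neg_mul]
    calc _ ≤ (s ^ s * (Real.pi ^ (-s) * ‖x‖ ^ (-a) * t ^ s)) *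
          Real.exp (-(t / (4 * Real.pi))) * t ^ ((α - (N : ℝ)) / 2 - 1) := by gcongr
      _ = _ := by ring
  · rw [integral_const_mul, ← hI]; ring

theorem stronglyMeasurable_besselKernel {N : ℕ} (α : ℝ) :
    StronglyMeasurable (besselKernel (N := N) α) := by
  unfold besselKernel
  refine StronglyMeasurable.const_mul ?_ _
  refine StronglyMeasurable.integral_prod_right' (f := fun z : EuclideanSpace ℝ (Fin N) × ℝ =>
    Real.exp (-(Real.pi / z.2) * ‖z.1‖ ^ 2) * Real.exp (-(z.2 / (4 * Real.pi))) *
        z.2 ^ ((α - (N : ℝ)) / 2 - 1)) ?_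
  exact Measurable.stronglyMeasurable (by fun_prop)

/-- Two power bounds suffice: an exponent just above `N - α` near the origin, and one larger than
`N` at infinity, in place of the true exponential decay. -/
theorem memLp_besselKernel {N : ℕ} {α r : ℝ} (hα : 0 < α) (hN : α < N) (hr : 1 ≤ r)
    (h : ((N : ℝ) - α) * r < N) :
    MemLp (besselKernel (N := N) α) (ENNReal.ofReal r) volume := by
  have hr0 : 0 < r := by linarith
  have hN0 : 0 < N := by
    have : (0 : ℝ) < N := hα.trans hN
    exact_mod_cast this
  have : NeZero N := ⟨hN0.ne'⟩
  have : Nontrivial (EuclideanSpace ℝ (Fin N)) :=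
    Module.nontrivial_of_finrank_pos (R := ℝ) (by simpa using hN0)
  obtain ⟨a, ha1, ha2⟩ : ∃ a, (N : ℝ) - α < a ∧ a < N / r :=
    exists_between ((lt_div_iff₀ hr0).2 h)
  have ha3 : a * r < N := (lt_div_iff₀ hr0).1 ha2
  have ha0 : 0 < a := by linarith
  obtain ⟨C, hC, hCb⟩ := exists_norm_besselKernel_le (N := N) ha0 ha1
  -- Any exponent exceeding `N` would serve at infinity; `2N - α` does because `α < N`.
  have hb0 : 0 < 2 * (N : ℝ) - α := by linarith
  have hb1 : (N : ℝ) < (2 * (N : ℝ) - α) * r := by nlinarith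
  obtain ⟨D, hD, hDb⟩ := exists_norm_besselKernel_le (N := N) (α := α) hb0 (by linarith)
  set b := 2 * (N : ℝ) - α
  let f : ℝ → ℝ := fun y => if y ≤ 1 then C ^ r * y ^ (-(a * r)) else D ^ r * y ^ (-(b * r))
  have hf : Integrable (fun x : EuclideanSpace ℝ (Fin N) => f ‖x‖) volume := by
    rw [integrable_fun_norm_addHaar, finrank_euclideanSpace_fin, ← Set.Ioc_union_Ioi_eq_Ioi
      (zero_le_one' ℝ), integrableOn_union]
    have hpow (y c : ℝ) (hy : 0 < y) : y ^ (N - 1) * y ^ (-c) = y ^ ((N : ℝ) - 1 - c) := by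
      rw [← Real.rpow_natCast, ← Real.rpow_add hy, Nat.cast_sub hN0]
      congr 1; push_cast; ring
    constructor
    · have h1 : IntegrableOn (fun y : ℝ => C ^ r * y ^ ((N : ℝ) - 1 - a * r)) (Set.Ioc 0 1) := by
        refine Integrable.const_mul ?_ _
        exact (intervalIntegrable_iff_integrableOn_Ioc_of_le zero_le_one).1
          (intervalIntegral.intervalIntegrable_rpow' (by linarith))
      refine h1.congr_fun (fun y hy => ?_) measurableSet_Ioc
      simp only [f, if_pos hy.2, smul_eq_mul]
      rw [← hpow _ _ hy.1]; ring
    · have h1 : IntegrableOn (fun y : ℝ => D ^ r * y ^ ((N : ℝ) - 1 - b * r)) (Set.Ioi 1) :=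
        (integrableOn_Ioi_rpow_of_lt (by linarith) one_pos).const_mul _
      refine h1.congr_fun (fun y hy => ?_) measurableSet_Ioi
      have hy1 : (1 : ℝ) < y := hy
      simp only [f, if_neg (not_le.2 hy1), smul_eq_mul]
      rw [← hpow _ _ (by linarith)]; ring
  have hm : AEStronglyMeasurable (besselKernel (N := N) α) volume :=
    (stronglyMeasurable_besselKernel α).aestronglyMeasurable
  rw [← integrable_norm_rpow_iff hm (by simpa using hr0) ENNReal.ofReal_ne_top,
    ENNReal.toReal_ofReal hr0.le]
  refine hf.mono' ((hm.norm.aemeasurable.pow_const r).aestronglyMeasurable) ?_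
  filter_upwards [Measure.ae_ne volume (0 : EuclideanSpace ℝ (Fin N))] with x hx
  rw [Real.norm_of_nonneg (by positivity)]
  have aux (K c : ℝ) (hK : 0 ≤ K) (hb : ‖besselKernel α x‖ ≤ K * ‖x‖ ^ (-c)) :
      ‖besselKernel α x‖ ^ r ≤ K ^ r * ‖x‖ ^ (-(c * r)) := by
    refine (Real.rpow_le_rpow (norm_nonneg _) hb hr0.le).trans_eq ?_
    rw [Real.mul_rpow hK (by positivity), ← Real.rpow_mul (norm_nonneg _), neg_mul]
  by_cases hx1 : ‖x‖ ≤ 1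
  · simpa only [f, if_pos hx1] using aux C a hC (hCb x hx)
  · simpa only [f, if_neg hx1] using aux D b hD (hDb x hx)

/-! ### Convolutions of real functions and translations in `L^p` -/

section Young

variable {E : Type*} [NormedAddCommGroup E] [NormedSpace ℝ E] [FiniteDimensional ℝ E]
  [MeasurableSpace E] [BorelSpace E] {μ : Measure E} [μ.IsAddHaarMeasure]

theorem eLpNorm_ofReal_eq_lintegral {X F : Type*} [MeasurableSpace X] [NormedAddCommGroup F]
    {ν : Measure X} (f : X → F) {p : ℝ} (hp : 0 < p) :
    eLpNorm f (ENNReal.ofReal p) ν = (∫⁻ x, ‖f x‖ₑ ^ p ∂ν) ^ (1 / p) := by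
  rw [eLpNorm_eq_lintegral_rpow_enorm_toReal (by simpa using hp) ENNReal.ofReal_ne_top,
    ENNReal.toReal_ofReal hp.le]

theorem lintegral_enorm_rpow_eq_eLpNorm {X F : Type*} [MeasurableSpace X] [NormedAddCommGroup F]
    {ν : Measure X} (f : X → F) {p : ℝ} (hp : 0 < p) :
    ∫⁻ x, ‖f x‖ₑ ^ p ∂ν = eLpNorm f (ENNReal.ofReal p) ν ^ p := by
  rw [eLpNorm_ofReal_eq_lintegral f hp, ← ENNReal.rpow_mul, one_div_mul_cancel hp.ne',
    ENNReal.rpow_one]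

theorem lintegral_convolution_enorm_rpow_le {f g : E → ℝ} (hf : AEStronglyMeasurable f μ)
    (hg : AEStronglyMeasurable g μ) {p q r : ℝ} (hp : 0 < p) (hr : 0 < r) (hpq : p ≤ q)
    (hrq : r ≤ q) (h : 1 / p + 1 / r = 1 + 1 / q) :
    ∫⁻ x, (∫⁻ t, ‖f t‖ₑ * ‖g (x - t)‖ₑ ∂μ) ^ q ∂μ ≤
      (eLpNorm f (ENNReal.ofReal p) μ * eLpNorm g (ENNReal.ofReal r) μ) ^ q := by
  have hq : 0 < q := hp.trans_le hpq
  refine (lintegral_convolution_rpow_le hf.enorm hg.enorm hp hr hpq hrq h).trans_eq ?_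
  rw [lintegral_enorm_rpow_eq_eLpNorm _ hp, lintegral_enorm_rpow_eq_eLpNorm _ hr,
    ENNReal.mul_rpow_of_nonneg _ _ hq.le, ← ENNReal.rpow_mul, ← ENNReal.rpow_mul,
    mul_div_cancel₀ _ hp.ne', mul_div_cancel₀ _ hr.ne']

/-- **Young's convolution inequality**. -/
theorem eLpNorm_convolution_le {f g : E → ℝ} (hf : AEStronglyMeasurable f μ)
    (hg : AEStronglyMeasurable g μ) {p q r : ℝ} (hp : 0 < p) (hr : 0 < r) (hpq : p ≤ q)
    (hrq : r ≤ q) (h : 1 / p + 1 / r = 1 + 1 / q) :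
    eLpNorm (f ⋆[ContinuousLinearMap.mul ℝ ℝ, μ] g) (ENNReal.ofReal q) μ ≤
      eLpNorm f (ENNReal.ofReal p) μ * eLpNorm g (ENNReal.ofReal r) μ := by
  have hq : 0 < q := hp.trans_le hpq
  rw [← ENNReal.rpow_le_rpow_iff hq, ← lintegral_enorm_rpow_eq_eLpNorm _ hq]
  refine le_trans (lintegral_mono fun x => ?_)
    (lintegral_convolution_enorm_rpow_le hf hg hp hr hpq hrq h)
  refine ENNReal.rpow_le_rpow ?_ hq.le
  refine (enorm_integral_le_lintegral_enorm _).trans_eq (lintegral_congr fun t => ?_)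
  simp [enorm_mul]

theorem ae_convolutionExistsAt {f g : E → ℝ} {p q r : ℝ} (hf : MemLp f (ENNReal.ofReal p) μ)
    (hg : MemLp g (ENNReal.ofReal r) μ) (hp : 0 < p) (hr : 0 < r) (hpq : p ≤ q)
    (hrq : r ≤ q) (h : 1 / p + 1 / r = 1 + 1 / q) :
    ∀ᵐ x ∂μ, ConvolutionExistsAt f g x (ContinuousLinearMap.mul ℝ ℝ) μ := by
  have hq : 0 < q := hp.trans_le hpq
  have hfin := (lintegral_convolution_enorm_rpow_le hf.1 hg.1 hp hr hpq hrq h).trans_lt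
    (ENNReal.rpow_lt_top_of_nonneg hq.le (ENNReal.mul_lt_top hf.2 hg.2).ne)
  have hmeas : AEMeasurable (fun x => ∫⁻ t, ‖f t‖ₑ * ‖g (x - t)‖ₑ ∂μ) μ := by
    have := (hf.1.convolution_integrand (ContinuousLinearMap.mul ℝ ℝ) hg.1).enorm
    simpa [enorm_mul] using this.lintegral_prod_right'
  filter_upwards [ae_lt_top' (hmeas.pow_const q) hfin.ne] with x hx
  refine ⟨hf.1.convolution_integrand_snd _ hg.1 x, ?_⟩
  have := (ENNReal.rpow_lt_top_iff_of_pos hq).1 hx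
  simpa [HasFiniteIntegral, enorm_mul] using this

omit [NormedSpace ℝ E] [FiniteDimensional ℝ E] in
theorem convolution_comp_add_right (f g : E → ℝ) (x h : E) :
    (f ⋆[ContinuousLinearMap.mul ℝ ℝ, μ] g) (x + h) =
      ((fun t => f (t + h)) ⋆[ContinuousLinearMap.mul ℝ ℝ, μ] g) x := by
  rw [convolution_def, convolution_def, ← integral_add_right_eq_self _ h]
  simp

/-- Translation may be moved onto `f`, so the difference is the convolution of `f(· + h) - f` with
`g`. Splitting the Bochner integral needs both convolutions to exist, which holds almost everywhere.
-/
theorem eLpNorm_convolution_translate_sub_le {f g : E → ℝ} {p q r : ℝ}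
    (hf : MemLp f (ENNReal.ofReal p) μ) (hg : MemLp g (ENNReal.ofReal r) μ) (hp : 0 < p)
    (hr : 0 < r) (hpq : p ≤ q) (hrq : r ≤ q) (hpqr : 1 / p + 1 / r = 1 + 1 / q) (h : E) :
    eLpNorm (fun x => (f ⋆[ContinuousLinearMap.mul ℝ ℝ, μ] g) (x + h) -
        (f ⋆[ContinuousLinearMap.mul ℝ ℝ, μ] g) x) (ENNReal.ofReal q) μ ≤
      eLpNorm (fun x => f (x + h) - f x) (ENNReal.ofReal p) μ *
        eLpNorm g (ENNReal.ofReal r) μ := by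
  have hfh : MemLp (fun x => f (x + h)) (ENNReal.ofReal p) μ :=
    hf.comp_measurePreserving (measurePreserving_add_right μ h)
  refine le_trans (le_of_eq (eLpNorm_congr_ae ?_))
    (eLpNorm_convolution_le (hfh.sub hf).1 hg.1 hp hr hpq hrq hpqr)
  filter_upwards [ae_convolutionExistsAt hf hg hp hr hpq hrq hpqr,
    ae_convolutionExistsAt hfh hg hp hr hpq hrq hpqr] with x h1 h2
  rw [convolution_comp_add_right, convolution_def, convolution_def, convolution_def,
    ← integral_sub h2.integrable h1.integrable]
  simp

theorem aestronglyMeasurable_convolution {f g : E → ℝ} (hf : AEStronglyMeasurable f μ)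
    (hg : AEStronglyMeasurable g μ) :
    AEStronglyMeasurable (f ⋆[ContinuousLinearMap.mul ℝ ℝ, μ] g) μ :=
  (hf.convolution_integrand (ContinuousLinearMap.mul ℝ ℝ) hg).integral_prod_right'

/-- Continuity of translations in `L^p`. -/
theorem tendsto_eLpNorm_translate_sub {f : E → ℝ} {p : ℝ≥0∞} (hp : 1 ≤ p) (hp' : p ≠ ∞)
    (hf : MemLp f p μ) :
    Tendsto (fun h => eLpNorm (fun x => f (x + h) - f x) p μ) (𝓝 0) (𝓝 0) := by
  have : Fact (1 ≤ p) := ⟨hp⟩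
  have hmp (h : E) : MeasurePreserving (ContinuousMap.addRight h) μ μ :=
    measurePreserving_add_right μ h
  have hc : Continuous (fun h : E => ContinuousMap.addRight h) :=
    ContinuousMap.continuous_of_continuous_uncurry _ (by
      simp only [Function.uncurry_def, ContinuousMap.coe_addRight]; fun_prop)
  -- Composition with a measure-preserving map is continuous in the map for the compact-open
  -- topology, and `h ↦ (· + h)` is continuous into that space.
  have := (continuous_const (y := hf.toLp f)).compMeasurePreservingLp hc hmp hp'
  have h0 := this.tendsto 0
  have e (h : E) : Lp.compMeasurePreserving (ContinuousMap.addRight h) (hmp h) (hf.toLp f) =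
      (hf.comp_measurePreserving (hmp h)).toLp _ :=
    Lp.toLp_compMeasurePreserving hf (hmp h)
  simp only [e] at h0
  rw [Lp.tendsto_Lp_iff_tendsto_eLpNorm''] at h0
  refine h0.congr fun h => eLpNorm_congr_ae (Eventually.of_forall fun x => ?_)
  simp

end Young

/-! ### Averages over balls -/

section BallAverage

variable {E : Type*} [NormedAddCommGroup E] [NormedSpace ℝ E] [FiniteDimensional ℝ E]
  [MeasurableSpace E] [BorelSpace E] {μ : Measure E} [μ.IsAddHaarMeasure]

omit [NormedSpace ℝ E] [FiniteDimensional ℝ E] in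
theorem setIntegral_ball_eq_add_left (u : E → ℝ) (x : E) (δ : ℝ) :
    ∫ y in Metric.ball x δ, u y ∂μ = ∫ h in Metric.ball 0 δ, u (x + h) ∂μ := by
  rw [← (measurePreserving_add_left μ x).setIntegral_preimage_emb
    (measurableEmbedding_addLeft x) u (Metric.ball x δ)]
  simp

omit [BorelSpace E] in
theorem isProbabilityMeasure_cond_ball {δ : ℝ} (hδ : 0 < δ) :
    IsProbabilityMeasure (ProbabilityTheory.cond μ (Metric.ball 0 δ)) :=
  ProbabilityTheory.cond_isProbabilityMeasure_of_finite
    (Metric.measure_ball_pos μ 0 hδ).ne' measure_ball_lt_top.ne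

omit [NormedSpace ℝ E] [FiniteDimensional ℝ E] in
theorem setAverage_ball_eq_integral_cond (u : E → ℝ) (x : E) (δ : ℝ) :
    ⨍ y in Metric.ball x δ, u y ∂μ =
      ∫ h, u (x + h) ∂(ProbabilityTheory.cond μ (Metric.ball 0 δ)) := by
  rw [setAverage_eq, setIntegral_ball_eq_add_left, ProbabilityTheory.cond, integral_smul_measure,
    Measure.real, Measure.addHaar_ball_center, ENNReal.toReal_inv]

/-- As `u` is only almost everywhere measurable, addition must pull null sets back to null sets;
this survives conditioning, which is absolutely continuous. -/
theorem aestronglyMeasurable_prod_add {u : E → ℝ} (hu : AEStronglyMeasurable u μ) (s : Set E) :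
    AEStronglyMeasurable (fun z : E × E => u (z.1 + z.2))
      (μ.prod (ProbabilityTheory.cond μ s)) := by
  have h : Measure.QuasiMeasurePreserving (fun z : E × E => z.1 + z.2) (μ.prod μ) μ :=
    Measure.quasiMeasurePreserving_snd.comp (measurePreserving_prod_add μ μ).quasiMeasurePreserving
  exact (hu.comp_quasiMeasurePreserving h).mono_ac
    (Measure.AbsolutelyContinuous.rfl.prod ProbabilityTheory.cond_absolutelyContinuous)

theorem aestronglyMeasurable_setAverage_ball {u : E → ℝ} (hu : AEStronglyMeasurable u μ)
    (δ : ℝ) : AEStronglyMeasurable (fun x => ⨍ y in Metric.ball x δ, u y ∂μ) μ := by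
  simp only [setAverage_ball_eq_integral_cond]
  exact (aestronglyMeasurable_prod_add hu _).integral_prod_right'

/-- A function is close in `L^q` to its averages over small balls as soon as it is close to its
small translates. -/
theorem eLpNorm_setAverage_ball_sub_le {u : E → ℝ} {q δ : ℝ} {ε : ℝ≥0∞} (hq : 1 ≤ q)
    (hδ : 0 < δ) (hu : MemLp u (ENNReal.ofReal q) μ)
    (h : ∀ h : E, ‖h‖ < δ →
      eLpNorm (fun x => u (x + h) - u x) (ENNReal.ofReal q) μ ≤ ε) :
    eLpNorm (fun x => (⨍ y in Metric.ball x δ, u y ∂μ) - u x) (ENNReal.ofReal q) μ ≤ ε := by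
  have hq0 : 0 < q := by linarith
  have hq1 : 1 ≤ ENNReal.ofReal q := by simpa using hq
  set ν := ProbabilityTheory.cond μ (Metric.ball (0 : E) δ) with hν
  have : IsProbabilityMeasure ν := isProbabilityMeasure_cond_ball hδ
  have hmeas : AEStronglyMeasurable (fun z : E × E => u (z.1 + z.2) - u z.1) (μ.prod ν) :=
    (aestronglyMeasurable_prod_add hu.1 _).sub
      (hu.1.comp_quasiMeasurePreserving Measure.quasiMeasurePreserving_fst)
  -- Jensen's inequality, in the form that `L^q` norms for a probability measure increase with the
  -- exponent. Tonelli then reduces the claim to single translates.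
  have hpt : ∀ᵐ x ∂μ, ‖(⨍ y in Metric.ball x δ, u y ∂μ) - u x‖ₑ ^ q ≤
      ∫⁻ h, ‖u (x + h) - u x‖ₑ ^ q ∂ν := by
    filter_upwards [hmeas.prodMk_left] with x hx
    have hint : Integrable (fun h => u (x + h)) ν := by
      refine Integrable.smul_measure ?_ (by simp [(Metric.measure_ball_pos μ 0 hδ).ne'])
      have hux : MemLp (fun h => u (x + h)) (ENNReal.ofReal q) μ :=
        hu.comp_measurePreserving (measurePreserving_add_left μ x)
      have hfin : IsFiniteMeasure (μ.restrict (Metric.ball (0 : E) δ)) :=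
        ⟨by simpa using measure_ball_lt_top⟩
      exact (hux.restrict _).integrable hq1
    have heq : (⨍ y in Metric.ball x δ, u y ∂μ) - u x = ∫ h, (u (x + h) - u x) ∂ν := by
      rw [setAverage_ball_eq_integral_cond, ← hν, integral_sub hint (integrable_const _)]
      simp
    rw [heq, lintegral_enorm_rpow_eq_eLpNorm _ hq0]
    refine ENNReal.rpow_le_rpow ((enorm_integral_le_lintegral_enorm _).trans ?_) hq0.le
    rw [← eLpNorm_one_eq_lintegral_enorm]
    exact eLpNorm_le_eLpNorm_of_exponent_le hq1 hx
  rw [← ENNReal.rpow_le_rpow_iff hq0, ← lintegral_enorm_rpow_eq_eLpNorm _ hq0]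
  calc _ ≤ ∫⁻ x, ∫⁻ h, ‖u (x + h) - u x‖ₑ ^ q ∂ν ∂μ := lintegral_mono_ae hpt
    _ = ∫⁻ h, ∫⁻ x, ‖u (x + h) - u x‖ₑ ^ q ∂μ ∂ν :=
      lintegral_lintegral_swap (hmeas.enorm.pow_const q)
    _ ≤ ∫⁻ _, ε ^ q ∂ν := by
      refine lintegral_mono_ae ?_
      filter_upwards [ProbabilityTheory.ae_cond_mem Metric.isOpen_ball.measurableSet] with y hy
      rw [lintegral_enorm_rpow_eq_eLpNorm _ hq0]
      exact ENNReal.rpow_le_rpow (h y (by simpa using hy)) hq0.le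
    _ = ε ^ q := by simp

omit [NormedSpace ℝ E] [FiniteDimensional ℝ E] [μ.IsAddHaarMeasure] in
-- Moves the dependence on `x` from the domain to the integrand, as Tonelli requires.
theorem setLIntegral_ball_eq_lintegral_indicator (w : E → ℝ≥0∞) (δ : ℝ) (x : E) :
    ∫⁻ y in Metric.ball x δ, w y ∂μ =
      ∫⁻ y, {z : E × E | dist z.2 z.1 < δ}.indicator (fun z => w z.2) (x, y) ∂μ := by
  rw [← lintegral_indicator Metric.isOpen_ball.measurableSet]
  rfl

omit [μ.IsAddHaarMeasure] in
theorem aemeasurable_indicator_dist_lt [SFinite μ] {w : E → ℝ≥0∞} (hw : AEMeasurable w μ) (δ : ℝ) :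
    AEMeasurable ({z : E × E | dist z.2 z.1 < δ}.indicator (fun z => w z.2)) (μ.prod μ) := by
  have hS : MeasurableSet {z : E × E | dist z.2 z.1 < δ} :=
    measurableSet_lt (by fun_prop) measurable_const
  have h : AEMeasurable (fun z : E × E => w z.2) (μ.prod μ) :=
    hw.comp_quasiMeasurePreserving Measure.quasiMeasurePreserving_snd
  exact h.indicator hS

theorem aemeasurable_setLIntegral_ball {w : E → ℝ≥0∞} (hw : AEMeasurable w μ) (δ : ℝ) :
    AEMeasurable (fun x => ∫⁻ y in Metric.ball x δ, w y ∂μ) μ := by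
  simp only [setLIntegral_ball_eq_lintegral_indicator]
  exact (aemeasurable_indicator_dist_lt hw δ).lintegral_prod_right'

theorem lintegral_setLIntegral_ball {w : E → ℝ≥0∞} (hw : AEMeasurable w μ) (δ : ℝ) :
    ∫⁻ x, ∫⁻ y in Metric.ball x δ, w y ∂μ ∂μ = μ (Metric.ball 0 δ) * ∫⁻ y, w y ∂μ := by
  simp only [setLIntegral_ball_eq_lintegral_indicator]
  rw [lintegral_lintegral_swap (f := fun x y =>
      {z : E × E | dist z.2 z.1 < δ}.indicator (fun z => w z.2) (x, y))
      (aemeasurable_indicator_dist_lt hw δ), ← lintegral_const_mul'' _ hw]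
  refine lintegral_congr fun y => ?_
  have h2 : (fun x => {z : E × E | dist z.2 z.1 < δ}.indicator (fun z => w z.2) (x, y)) =
      (Metric.ball y δ).indicator (fun _ => w y) := by
    ext x
    simp [Set.indicator, dist_comm]
  rw [h2, lintegral_indicator_const Metric.isOpen_ball.measurableSet, Measure.addHaar_ball_center,
    mul_comm]

theorem aemeasurable_ofReal_weight_mul_sq {X : Type*} [MeasurableSpace X] {ν : Measure X}
    {V u : X → ℝ} (hV : AEMeasurable V ν) (hu : AEMeasurable u ν) :
    AEMeasurable (fun x => ENNReal.ofReal (V x * |u x| ^ 2)) ν := by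
  simp only [sq_abs]
  exact (hV.mul (hu.pow_const 2)).ennreal_ofReal

theorem enorm_setAverage_le {X : Type*} [MeasurableSpace X] {ν : Measure X} (u : X → ℝ)
    (s : Set X) : ‖⨍ y in s, u y ∂ν‖ₑ ≤ (ν s)⁻¹ * ∫⁻ y in s, ‖u y‖ₑ ∂ν := by
  rw [average_eq', Measure.restrict_apply_univ]
  refine (enorm_integral_le_lintegral_enorm _).trans_eq ?_
  rw [lintegral_smul_measure, smul_eq_mul]

/-- The Cauchy–Schwarz inequality with a weight. -/
theorem setLIntegral_enorm_sq_le {X : Type*} [MeasurableSpace X] {ν : Measure X} {V u : X → ℝ}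
    (hV : AEMeasurable V ν) (hVpos : ∀ᵐ x ∂ν, 0 < V x) (hu : AEMeasurable u ν) :
    (∫⁻ x, ‖u x‖ₑ ∂ν) ^ (2 : ℝ) ≤
      (∫⁻ x, ENNReal.ofReal (1 / V x) ∂ν) * ∫⁻ x, ENNReal.ofReal (V x * |u x| ^ 2) ∂ν := by
  have hc : (2 : ℝ).HolderConjugate 2 := Real.HolderConjugate.two_two
  set f : X → ℝ≥0∞ := fun x => ENNReal.ofReal (1 / V x) with hf
  set g : X → ℝ≥0∞ := fun x => ENNReal.ofReal (V x * |u x| ^ 2) with hg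
  have hfm : AEMeasurable f ν := (hV.const_div 1).ennreal_ofReal
  have hgm : AEMeasurable g ν := aemeasurable_ofReal_weight_mul_sq hV hu
  have key := ENNReal.lintegral_mul_le_Lp_mul_Lq ν hc (hfm.pow_const (1 / 2 : ℝ))
    (hgm.pow_const (1 / 2 : ℝ))
  have e : (1 / 2 : ℝ) * 2 = 1 := by norm_num
  simp only [← ENNReal.rpow_mul, e, ENNReal.rpow_one] at key
  -- Write `|u| = (1/V)^(1/2) (V u²)^(1/2)`.
  have h1 : ∫⁻ x, ‖u x‖ₑ ∂ν =
      ∫⁻ x, ((fun x => f x ^ (1 / 2 : ℝ)) * fun x => g x ^ (1 / 2 : ℝ)) x ∂ν := by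
    refine lintegral_congr_ae ?_
    filter_upwards [hVpos] with x hx
    simp only [Pi.mul_apply, hf, hg]
    rw [← ENNReal.mul_rpow_of_nonneg _ _ (by norm_num), ← ENNReal.ofReal_mul (by positivity),
      one_div, inv_mul_cancel_left₀ hx.ne', ENNReal.ofReal_rpow_of_nonneg (by positivity)
      (by norm_num), ← Real.sqrt_eq_rpow, Real.sqrt_sq (abs_nonneg _), ← Real.norm_eq_abs,
      ofReal_norm]
  rw [h1]
  refine (ENNReal.rpow_le_rpow key zero_le_two).trans_eq ?_
  rw [ENNReal.mul_rpow_of_nonneg _ _ zero_le_two, ← ENNReal.rpow_mul, ← ENNReal.rpow_mul, e,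
    ENNReal.rpow_one, ENNReal.rpow_one]

/-- Smallness of ball averages in `L^q` on a set near which `1 / V` has small integrals. -/
theorem setLIntegral_setAverage_ball_rpow_le {V u : E → ℝ} (hV : AEMeasurable V μ)
    (hVpos : ∀ᵐ x ∂μ, 0 < V x) (hu : AEMeasurable u μ) {q δ : ℝ} (hq : 2 ≤ q) (hδ1 : δ ≤ 1)
    {K η : ℝ≥0∞} (hK : ∫⁻ x, ENNReal.ofReal (V x * |u x| ^ 2) ∂μ ≤ K) {s : Set E}
    (hs : MeasurableSet s)
    (hη : ∀ x ∈ s, ∫⁻ y in Metric.ball x 1, ENNReal.ofReal (1 / V y) ∂μ ≤ η) :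
    ∫⁻ x in s, ‖⨍ y in Metric.ball x δ, u y ∂μ‖ₑ ^ q ∂μ ≤
      (μ (Metric.ball 0 δ))⁻¹ ^ q * η ^ (q / 2) * K ^ (q / 2) * μ (Metric.ball 0 1) := by
  have hq0 : 0 < q := by linarith
  have hq2 : 0 ≤ q / 2 - 1 := by linarith
  set w : E → ℝ≥0∞ := fun x => ENNReal.ofReal (V x * |u x| ^ 2) with hw
  have hwm : AEMeasurable w μ := aemeasurable_ofReal_weight_mul_sq hV hu
  set c := (μ (Metric.ball (0 : E) δ))⁻¹ with hc
  have hpt : ∀ x ∈ s, ‖⨍ y in Metric.ball x δ, u y ∂μ‖ₑ ^ q ≤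
      c ^ q * η ^ (q / 2) * K ^ (q / 2 - 1) * ∫⁻ y in Metric.ball x 1, w y ∂μ := by
    intro x hx
    -- The integral is enlarged to the unit ball, where `η` controls `1 / V`; the prefactor keeps
    -- the volume of the small ball.
    have h1 : ‖⨍ y in Metric.ball x δ, u y ∂μ‖ₑ ≤ c * ∫⁻ y in Metric.ball x 1, ‖u y‖ₑ ∂μ := by
      refine (enorm_setAverage_le u _).trans ?_
      rw [Measure.addHaar_ball_center]
      gcongr
    have h2 := setLIntegral_enorm_sq_le (ν := μ.restrict (Metric.ball x 1)) hV.restrict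
      (ae_restrict_of_ae hVpos) hu.restrict
    set W := ∫⁻ y in Metric.ball x 1, w y ∂μ
    have hWK : W ≤ K := (setLIntegral_le_lintegral _ _).trans hK
    have e : (∫⁻ y in Metric.ball x 1, ‖u y‖ₑ ∂μ) ^ q =
        ((∫⁻ y in Metric.ball x 1, ‖u y‖ₑ ∂μ) ^ (2 : ℝ)) ^ (q / 2) := by
      rw [← ENNReal.rpow_mul]; congr 1; ring
    -- Since `q ≥ 2`, one factor `W` can be kept: its integral over `x` is finite, whereas the other
    -- powers are bounded by `K`.
    have hW : W ^ (q / 2) ≤ K ^ (q / 2 - 1) * W := by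
      calc W ^ (q / 2) = W ^ (q / 2 - 1) * W := by
            nth_rewrite 3 [← ENNReal.rpow_one W]
            rw [← ENNReal.rpow_add_of_nonneg _ _ hq2 zero_le_one]; congr 1; ring
        _ ≤ _ := by gcongr
    calc _ ≤ (c * ∫⁻ y in Metric.ball x 1, ‖u y‖ₑ ∂μ) ^ q := ENNReal.rpow_le_rpow h1 hq0.le
      _ = c ^ q * ((∫⁻ y in Metric.ball x 1, ‖u y‖ₑ ∂μ) ^ (2 : ℝ)) ^ (q / 2) := by
        rw [ENNReal.mul_rpow_of_nonneg _ _ hq0.le, e]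
      _ ≤ c ^ q * (η * W) ^ (q / 2) := by
        gcongr
        exact h2.trans (by gcongr; exact hη x hx)
      _ = c ^ q * η ^ (q / 2) * W ^ (q / 2) := by
        rw [ENNReal.mul_rpow_of_nonneg _ _ (by positivity), mul_assoc]
      _ ≤ c ^ q * η ^ (q / 2) * (K ^ (q / 2 - 1) * W) := by gcongr
      _ = _ := by ring
  calc _ ≤ ∫⁻ x in s, c ^ q * η ^ (q / 2) * K ^ (q / 2 - 1) *
        ∫⁻ y in Metric.ball x 1, w y ∂μ ∂μ := setLIntegral_mono' hs hpt
    _ ≤ ∫⁻ x, c ^ q * η ^ (q / 2) * K ^ (q / 2 - 1) *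
        ∫⁻ y in Metric.ball x 1, w y ∂μ ∂μ := setLIntegral_le_lintegral _ _
    _ = c ^ q * η ^ (q / 2) * K ^ (q / 2 - 1) * (μ (Metric.ball 0 1) * ∫⁻ y, w y ∂μ) := by
        rw [lintegral_const_mul'' _ (aemeasurable_setLIntegral_ball hwm 1), lintegral_setLIntegral_ball hwm]
    _ ≤ c ^ q * η ^ (q / 2) * K ^ (q / 2 - 1) * (μ (Metric.ball 0 1) * K) := by gcongr
    _ = c ^ q * η ^ (q / 2) * (K ^ (q / 2 - 1) * K) * μ (Metric.ball 0 1) := by ring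
    _ = _ := by
        congr 2
        nth_rewrite 2 [← ENNReal.rpow_one K]
        rw [← ENNReal.rpow_add_of_nonneg _ _ hq2 zero_le_one]; congr 1; ring

end BallAverage

/-! ### Weak compactness and the Kolmogorov–Riesz argument -/

/-- Bounded sequences in a separable Hilbert space have weakly convergent subsequences. -/
theorem exists_strictMono_tendsto_inner {H : Type*} [NormedAddCommGroup H]
    [InnerProductSpace ℝ H] [CompleteSpace H] [TopologicalSpace.SeparableSpace H] {v : ℕ → H}
    {M : ℝ} (hv : ∀ n, ‖v n‖ ≤ M) :
    ∃ (w : H) (φ : ℕ → ℕ), StrictMono φ ∧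
      ∀ z, Tendsto (fun n => inner ℝ (v (φ n)) z) atTop (𝓝 (inner ℝ w z)) := by
  have hmem (n : ℕ) : StrongDual.toWeakDual (InnerProductSpace.toDual ℝ H (v n)) ∈
      WeakDual.toStrongDual ⁻¹' Metric.closedBall (0 : StrongDual ℝ H) M := by
    simpa using hv n
  obtain ⟨w, -, φ, hφ, hw⟩ := WeakDual.isSeqCompact_closedBall ℝ H 0 M hmem
  refine ⟨(InnerProductSpace.toDual ℝ H).symm (WeakDual.toStrongDual w), φ, hφ, fun z => ?_⟩
  have h1 := ((WeakDual.eval_continuous z).tendsto w).comp hw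
  rw [InnerProductSpace.toDual_symm_apply]
  exact h1

section KolmogorovRiesz

variable {E : Type*} [NormedAddCommGroup E] [NormedSpace ℝ E] [FiniteDimensional ℝ E]
  [MeasurableSpace E] [BorelSpace E] {μ : Measure E} [μ.IsAddHaarMeasure]

/-- Ball integrals are inner products with indicators, so weak `L²` convergence suffices. One
subsequence serves all `x` and `δ`, which lets `δ` be chosen later, in terms of `ε`. -/
theorem exists_strictMono_tendsto_setAverage {u : ℕ → E → ℝ} (hu : ∀ n, MemLp (u n) 2 μ)
    {M : ℝ} (hM : ∀ n, eLpNorm (u n) 2 μ ≤ ENNReal.ofReal M) :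
    ∃ (w : E → ℝ) (φ : ℕ → ℕ), StrictMono φ ∧ ∀ (x : E) (δ : ℝ),
      Tendsto (fun n => ⨍ y in Metric.ball x δ, u (φ n) y ∂μ) atTop
        (𝓝 (⨍ y in Metric.ball x δ, w y ∂μ)) := by
  have : Fact ((2 : ℝ≥0∞) ≠ ∞) := ⟨by norm_num⟩
  have hb (n : ℕ) : ‖(hu n).toLp (u n)‖ ≤ max M 0 := by
    rw [Lp.norm_toLp]
    refine ENNReal.toReal_le_of_le_ofReal (le_max_right _ _) ((hM n).trans ?_)
    exact ENNReal.ofReal_le_ofReal (le_max_left _ _)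
  obtain ⟨w, φ, hφ, h⟩ := exists_strictMono_tendsto_inner hb
  refine ⟨w, φ, hφ, fun x δ => ?_⟩
  simp only [setAverage_eq]
  refine Tendsto.const_smul ?_ _
  have hms : MeasurableSet (Metric.ball x δ) := Metric.isOpen_ball.measurableSet
  have h1 := h (indicatorConstLp 2 hms (measure_ball_lt_top (μ := μ)).ne (1 : ℝ))
  have h2 (v : Lp ℝ 2 μ) : inner ℝ v (indicatorConstLp 2 hms
      (measure_ball_lt_top (μ := μ)).ne (1 : ℝ)) = ∫ y in Metric.ball x δ, v y ∂μ := by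
    rw [real_inner_comm, L2.inner_indicatorConstLp_one]
  simp only [h2] at h1
  convert! h1 using 2 with n
  exact setIntegral_congr_ae hms ((MemLp.coeFn_toLp (hu (φ n))).symm.mono fun y hy _ => hy)

omit [NormedSpace ℝ E] [FiniteDimensional ℝ E] in
theorem enorm_setAverage_ball_le_eLpNorm {u : E → ℝ} (hu : AEStronglyMeasurable u μ)
    (x : E) (δ : ℝ) :
    ‖⨍ y in Metric.ball x δ, u y ∂μ‖ₑ ≤
      (μ (Metric.ball 0 δ))⁻¹ * (eLpNorm u 2 μ * μ (Metric.ball 0 δ) ^ (1 / 2 : ℝ)) := by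
  refine (enorm_setAverage_le u _).trans ?_
  rw [Measure.addHaar_ball_center, ← eLpNorm_one_eq_lintegral_enorm]
  gcongr
  refine (eLpNorm_le_eLpNorm_mul_rpow_measure_univ one_le_two hu.restrict).trans ?_
  rw [Measure.restrict_apply_univ, Measure.addHaar_ball_center]
  norm_num
  gcongr
  exact Measure.restrict_le_self

theorem eLpNorm_le_add_restrict_compl {X : Type*} [MeasurableSpace X] {ν : Measure X} {f : X → ℝ}
    (hf : AEStronglyMeasurable f ν) {p : ℝ≥0∞} (hp : 1 ≤ p) {s : Set X} (hs : MeasurableSet s) :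
    eLpNorm f p ν ≤ eLpNorm f p (ν.restrict s) + eLpNorm f p (ν.restrict sᶜ) := by
  rw [← eLpNorm_indicator_eq_eLpNorm_restrict hs, ← eLpNorm_indicator_eq_eLpNorm_restrict hs.compl]
  nth_rewrite 1 [← Set.indicator_self_add_compl s f]
  exact eLpNorm_add_le (hf.indicator hs) (hf.indicator hs.compl) hp

/-- Pointwise convergence, a uniform bound, and uniformly small tails yield a Cauchy sequence in
`L^q`. -/
theorem tendsto_eLpNorm_sub_of_tendsto_of_tail {a : ℕ → E → ℝ} {b : E → ℝ} {q : ℝ} (hq : 1 ≤ q)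
    (ha : ∀ n, AEStronglyMeasurable (a n) μ) (hab : ∀ x, Tendsto (fun n => a n x) atTop (𝓝 (b x)))
    {C : ℝ≥0∞} (hC : C ≠ ∞) (hbd : ∀ n x, ‖a n x‖ₑ ≤ C)
    (htail : ∀ ε : ℝ≥0∞, 0 < ε → ∃ R : ℝ, ∀ n,
      eLpNorm (a n) (ENNReal.ofReal q) (μ.restrict (Metric.ball 0 R)ᶜ) ≤ ε) :
    Tendsto (fun p : ℕ × ℕ => eLpNorm (a p.1 - a p.2) (ENNReal.ofReal q) μ) atTop (𝓝 0) := by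
  have hq0 : 0 < q := by linarith
  have hq1 : 1 ≤ ENNReal.ofReal q := by simpa using hq
  -- On a ball the constant `(C + C) ^ q` is an integrable majorant.
  have hlocal (R : ℝ) : Tendsto (fun p : ℕ × ℕ => eLpNorm (a p.1 - a p.2) (ENNReal.ofReal q)
      (μ.restrict (Metric.ball 0 R))) atTop (𝓝 0) := by
    simp only [eLpNorm_ofReal_eq_lintegral _ hq0]
    have h1 : Tendsto (fun p : ℕ × ℕ => ∫⁻ x in Metric.ball 0 R, ‖(a p.1 - a p.2) x‖ₑ ^ q ∂μ)
        atTop (𝓝 (∫⁻ x in Metric.ball 0 R, 0 ∂μ)) := by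
      refine tendsto_lintegral_filter_of_dominated_convergence' (fun _ => (C + C) ^ q) ?_ ?_ ?_ ?_
      · exact Eventually.of_forall fun p => (((ha p.1).sub (ha p.2)).enorm.pow_const q).restrict
      · refine Eventually.of_forall fun p => Eventually.of_forall fun x => ?_
        refine ENNReal.rpow_le_rpow ((enorm_sub_le).trans ?_) hq0.le
        exact add_le_add (hbd _ _) (hbd _ _)
      · rw [lintegral_const, Measure.restrict_apply_univ]
        exact ENNReal.mul_ne_top (ENNReal.rpow_ne_top_of_nonneg hq0.le
          (ENNReal.add_ne_top.2 ⟨hC, hC⟩)) measure_ball_lt_top.ne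
      · refine Eventually.of_forall fun x => ?_
        have h2 : Tendsto (fun p : ℕ × ℕ => (a p.1 - a p.2) x) atTop (𝓝 (b x - b x)) := by
          rw [← prod_atTop_atTop_eq]
          exact ((hab x).comp tendsto_fst).sub ((hab x).comp tendsto_snd)
        rw [sub_self] at h2
        have h3 := (ENNReal.continuous_rpow_const (y := q)).tendsto _ |>.comp h2.enorm
        simpa [ENNReal.zero_rpow_of_pos hq0, Function.comp_def] using h3
    have h4 := (ENNReal.continuous_rpow_const (y := 1 / q)).tendsto _ |>.comp h1
    have h5 : (0 : ℝ≥0∞) ^ (1 / q) = 0 := ENNReal.zero_rpow_of_pos (by positivity)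
    simpa only [lintegral_zero, h5, Function.comp_def] using h4
  rw [ENNReal.tendsto_nhds_zero]
  intro ε hε
  obtain ⟨R, hR⟩ := htail (ε / 3) (ENNReal.div_pos hε.ne' (by norm_num))
  filter_upwards [(ENNReal.tendsto_nhds_zero.1 (hlocal R)) (ε / 3)
    (ENNReal.div_pos hε.ne' (by norm_num))] with p hp
  calc _ ≤ _ := eLpNorm_le_add_restrict_compl ((ha p.1).sub (ha p.2)) hq1
        (s := Metric.ball 0 R) Metric.isOpen_ball.measurableSet
    _ ≤ ε / 3 + (ε / 3 + ε / 3) := by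
        refine add_le_add hp ((eLpNorm_sub_le (ha p.1).restrict (ha p.2).restrict hq1).trans ?_)
        exact add_le_add (hR _) (hR _)
    _ = ε := by rw [← add_assoc]; exact ENNReal.add_thirds ε

/-- A version of the **Kolmogorov–Riesz theorem**, in which the tails of ball averages are assumed
to be small. -/
theorem exists_tendsto_eLpNorm_of_equicontinuous_of_tail {u : ℕ → E → ℝ} {q : ℝ} (hq : 1 ≤ q)
    (huq : ∀ n, MemLp (u n) (ENNReal.ofReal q) μ) (hu2 : ∀ n, MemLp (u n) 2 μ)
    {M : ℝ} (hM : ∀ n, eLpNorm (u n) 2 μ ≤ ENNReal.ofReal M)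
    (hequi : ∀ ε : ℝ≥0∞, 0 < ε → ∃ δ : ℝ, 0 < δ ∧ ∀ n (h : E), ‖h‖ < δ →
      eLpNorm (fun x => u n (x + h) - u n x) (ENNReal.ofReal q) μ ≤ ε)
    (htail : ∀ δ : ℝ, 0 < δ → δ ≤ 1 → ∀ ε : ℝ≥0∞, 0 < ε → ∃ R : ℝ, ∀ n,
      eLpNorm (fun x => ⨍ y in Metric.ball x δ, u n y ∂μ) (ENNReal.ofReal q)
        (μ.restrict (Metric.ball 0 R)ᶜ) ≤ ε) :
    ∃ f : E → ℝ, MemLp f (ENNReal.ofReal q) μ ∧ ∃ φ : ℕ → ℕ, StrictMono φ ∧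
      Tendsto (fun k => eLpNorm (u (φ k) - f) (ENNReal.ofReal q) μ) atTop (𝓝 0) := by
  have hq1 : 1 ≤ ENNReal.ofReal q := by simpa using hq
  have : Fact (1 ≤ ENNReal.ofReal q) := ⟨hq1⟩
  obtain ⟨w, φ, hφ, hw⟩ := exists_strictMono_tendsto_setAverage hu2 hM
  have hcauchy : CauchySeq fun n => (huq (φ n)).toLp (u (φ n)) := by
    rw [Lp.cauchySeq_Lp_iff_cauchySeq_eLpNorm]
    have e (p : ℕ × ℕ) : eLpNorm (⇑((huq (φ p.1)).toLp (u (φ p.1))) -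
        ⇑((huq (φ p.2)).toLp (u (φ p.2)))) (ENNReal.ofReal q) μ =
        eLpNorm (u (φ p.1) - u (φ p.2)) (ENNReal.ofReal q) μ :=
      eLpNorm_congr_ae ((MemLp.coeFn_toLp _).sub (MemLp.coeFn_toLp _))
    simp only [e]
    rw [ENNReal.tendsto_nhds_zero]
    intro ε hε
    have hε3 : 0 < ε / 3 := ENNReal.div_pos hε.ne' (by norm_num)
    obtain ⟨δ₀, hδ₀, hδ₀e⟩ := hequi (ε / 3) hε3
    -- The cap at `1` is what `htail` demands.
    set δ := min δ₀ 1
    have hδ : 0 < δ := lt_min hδ₀ one_pos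
    set A : ℕ → E → ℝ := fun n x => ⨍ y in Metric.ball x δ, u (φ n) y ∂μ with hA
    have hAm (n : ℕ) : AEStronglyMeasurable (A n) μ :=
      aestronglyMeasurable_setAverage_ball (huq (φ n)).1 δ
    have hAu (n : ℕ) : eLpNorm (A n - u (φ n)) (ENNReal.ofReal q) μ ≤ ε / 3 :=
      eLpNorm_setAverage_ball_sub_le hq hδ (huq (φ n)) fun h hh =>
        hδ₀e (φ n) h (hh.trans_le (min_le_left _ _))
    have hAbd (n : ℕ) (x : E) : ‖A n x‖ₑ ≤ (μ (Metric.ball 0 δ))⁻¹ *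
        (ENNReal.ofReal M * μ (Metric.ball 0 δ) ^ (1 / 2 : ℝ)) := by
      refine (enorm_setAverage_ball_le_eLpNorm (hu2 (φ n)).1 x δ).trans ?_
      gcongr
      exact hM _
    have hAC := tendsto_eLpNorm_sub_of_tendsto_of_tail hq hAm (fun x => hw x δ)
      (ENNReal.mul_ne_top (ENNReal.inv_ne_top.2 (Metric.measure_ball_pos μ 0 hδ).ne')
        (ENNReal.mul_ne_top ENNReal.ofReal_ne_top
          (ENNReal.rpow_ne_top_of_nonneg (by norm_num) measure_ball_lt_top.ne))) hAbd
      (fun η hη => (htail δ hδ (min_le_right _ _) η hη).imp fun R hR n => hR (φ n))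
    filter_upwards [(ENNReal.tendsto_nhds_zero.1 hAC) (ε / 3) hε3] with p hp
    have hsplit : u (φ p.1) - u (φ p.2) =
        (A p.1 - A p.2) - (A p.1 - u (φ p.1)) + (A p.2 - u (φ p.2)) := by
      ext x; simp only [Pi.sub_apply, Pi.add_apply]; ring
    have hm1 := (hAm p.1).sub (hAm p.2)
    have hm2 := (hAm p.1).sub (huq (φ p.1)).1
    have hm3 := (hAm p.2).sub (huq (φ p.2)).1
    rw [hsplit]
    calc _ ≤ _ := eLpNorm_add_le (hm1.sub hm2) hm3 hq1
      _ ≤ (ε / 3 + ε / 3) + ε / 3 :=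
        add_le_add ((eLpNorm_sub_le hm1 hm2 hq1).trans (add_le_add hp (hAu _))) (hAu _)
      _ = ε := ENNReal.add_thirds ε
  obtain ⟨f, hf⟩ := cauchySeq_tendsto_of_complete hcauchy
  refine ⟨f, Lp.memLp f, φ, hφ, ?_⟩
  refine ((Lp.tendsto_Lp_iff_tendsto_eLpNorm' _ f).1 hf).congr fun n => eLpNorm_congr_ae ?_
  exact (MemLp.coeFn_toLp _).sub (EventuallyEq.refl _ _)

end KolmogorovRiesz

/-! ### Consequences of the hypotheses on the potential -/

section Electric

variable {N : ℕ} {V : EuclideanSpace ℝ (Fin N) → ℝ}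

theorem IsCoerciveElectricPotential.exists_pos_le (hV : IsCoerciveElectricPotential V) :
    ∃ c : ℝ, 0 < c ∧ ∀ᵐ x, c ≤ V x := by
  obtain ⟨c, hc0, hc⟩ := EReal.lt_iff_exists_real_btwn.1 hV.essInf_pos
  refine ⟨c, by exact_mod_cast hc0, ?_⟩
  filter_upwards [ae_lt_of_lt_essInf hc] with x hx
  exact (EReal.coe_lt_coe_iff.1 hx).le

theorem IsCoerciveElectricPotential.ae_pos (hV : IsCoerciveElectricPotential V) :
    ∀ᵐ x, 0 < V x := by
  obtain ⟨c, hc, h⟩ := hV.exists_pos_le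
  exact h.mono fun x hx => hc.trans_le hx

theorem IsCoerciveElectricPotential.exists_lintegral_inv_le
    (hV : IsCoerciveElectricPotential V) (hVm : AEMeasurable V volume) {η : ℝ} (hη : 0 < η) :
    ∃ R : ℝ, ∀ x ∈ (Metric.ball (0 : EuclideanSpace ℝ (Fin N)) R)ᶜ,
      ∫⁻ y in Metric.ball x 1, ENNReal.ofReal (1 / V y) ≤ ENNReal.ofReal η := by
  obtain ⟨c, hc, hcV⟩ := hV.exists_pos_le
  have h1 := hV.tendsto_integral_inv.eventually (gt_mem_nhds hη)
  rw [← Metric.cobounded_eq_cocompact, (Metric.hasBasis_cobounded_compl_ball 0).eventually_iff]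
    at h1
  obtain ⟨R, -, hR⟩ := h1
  refine ⟨R, fun x hx => ?_⟩
  -- The bound `1 / V ≤ 1 / c` makes `1 / V` integrable on unit balls, so the Bochner integral in
  -- (V2) is not a default value `0`.
  rw [← ofReal_integral_eq_lintegral_ofReal]
  · exact ENNReal.ofReal_le_ofReal (hR hx).le
  · refine Measure.integrableOn_of_bounded (M := 1 / c) measure_ball_lt_top.ne
      (hVm.const_div 1).aestronglyMeasurable ?_
    filter_upwards [ae_restrict_of_ae hcV] with y hy
    rw [Real.norm_of_nonneg (by have := hc.trans_le hy; positivity)]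
    exact one_div_le_one_div_of_le hc hy
  · filter_upwards [ae_restrict_of_ae hV.ae_pos] with y hy
    simp only [Pi.zero_apply]
    positivity

theorem eLpNorm_two_eq_ofReal_sqrt {X : Type*} [MeasurableSpace X] {ν : Measure X} {g : X → ℝ}
    (hg : MemLp g 2 ν) : eLpNorm g 2 ν = ENNReal.ofReal (Real.sqrt (∫ x, |g x| ^ 2 ∂ν)) := by
  rw [MemLp.eLpNorm_eq_integral_rpow_norm two_ne_zero (by norm_num) hg, Real.sqrt_eq_rpow]
  norm_num

end Electric

/-! ### Estimates in the weighted Bessel space -/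

section Embedding

variable {N : ℕ} {α : ℝ} {V u : EuclideanSpace ℝ (Fin N) → ℝ}

theorem MemBesselSpace.memLp_besselOperator (hu : MemBesselSpace α u) :
    MemLp (besselOperator α u) 2 volume := by
  rw [besselOperator, dif_pos hu]
  exact hu.choose_spec.1

theorem MemBesselSpace.ae_eq_besselConv (hu : MemBesselSpace α u) :
    u =ᵐ[volume] besselConv α (besselOperator α u) := by
  rw [besselOperator, dif_pos hu]
  exact hu.choose_spec.2

theorem IsCoerciveElectricPotential.integral_weight_nonneg (hV : IsCoerciveElectricPotential V) :
    0 ≤ ∫ x, V x * |u x| ^ 2 :=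
  integral_nonneg_of_ae (hV.ae_pos.mono fun x hx => by simp only [Pi.zero_apply]; positivity)

theorem eLpNorm_besselOperator_le (hV : IsCoerciveElectricPotential V)
    (hu : u ∈ weightedSpace α V) :
    eLpNorm (besselOperator α u) 2 volume ≤ ENNReal.ofReal (weightedNorm α V u) := by
  rw [eLpNorm_two_eq_ofReal_sqrt hu.1.memLp_besselOperator]
  exact ENNReal.ofReal_le_ofReal (Real.sqrt_le_sqrt
    (le_add_of_nonneg_right hV.integral_weight_nonneg))

theorem lintegral_weight_le (hV : IsCoerciveElectricPotential V) (hu : u ∈ weightedSpace α V) :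
    ∫⁻ x, ENNReal.ofReal (V x * |u x| ^ 2) ≤ ENNReal.ofReal (weightedNorm α V u ^ 2) := by
  rw [← ofReal_integral_eq_lintegral_ofReal hu.2
    (hV.ae_pos.mono fun x hx => by simp only [Pi.zero_apply]; positivity)]
  refine ENNReal.ofReal_le_ofReal ?_
  have h0 : 0 ≤ ∫ x, |besselOperator α u x| ^ 2 := integral_nonneg fun x => by positivity
  rw [weightedNorm, Real.sq_sqrt (add_nonneg h0 hV.integral_weight_nonneg)]
  exact le_add_of_nonneg_left h0

/-- The exponent `r` with `1 / 2 + 1 / r = 1 + 1 / q` and the properties that make Young's inequality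
applicable to the Bessel kernel. -/
theorem exists_young_exponent {N α q : ℝ} (hN : 2 * α < N) (hq : 2 ≤ q)
    (hq' : q < 2 * N / (N - 2 * α)) :
    ∃ r : ℝ, 1 ≤ r ∧ r ≤ q ∧ 1 / r + 1 / 2 = 1 + 1 / q ∧ (N - α) * r < N := by
  have hq0 : 0 < q := by linarith
  have hs : 0 < 1 / 2 + 1 / q := by positivity
  have hq2 : 1 / q ≤ 1 / 2 := one_div_le_one_div_of_le two_pos hq
  refine ⟨1 / (1 / 2 + 1 / q), ?_, ?_, ?_, ?_⟩
  · rw [le_div_iff₀ hs]; linarith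
  · rw [div_le_iff₀ hs, mul_add, mul_one_div_cancel hq0.ne']; linarith
  · rw [one_div_one_div]; ring
  -- Subcriticality is `N/2 - α < N/q`; adding `N/2` gives `N - α < N/r`.
  · rw [lt_div_iff₀ (by linarith)] at hq'
    rw [mul_one_div, div_lt_iff₀ hs]
    have e : N * (1 / 2 + 1 / q) = N / 2 + N / q := by ring
    have : N / 2 - α < N / q := by rw [lt_div_iff₀ hq0]; linarith
    rw [e]; linarith

theorem aestronglyMeasurable_and_eLpNorm_le_of_memBesselSpace {q r : ℝ} (hr : 1 ≤ r) (hrq : r ≤ q) (hq : 2 ≤ q)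
    (hqr : 1 / r + 1 / 2 = 1 + 1 / q)
    (hG : MemLp (besselKernel (N := N) α) (ENNReal.ofReal r) volume)
    (hu : MemBesselSpace α u) :
    AEStronglyMeasurable u volume ∧ eLpNorm u (ENNReal.ofReal q) volume ≤
      eLpNorm (besselKernel (N := N) α) (ENNReal.ofReal r) volume *
        eLpNorm (besselOperator α u) 2 volume := by
  have hg := hu.memLp_besselOperator
  constructor
  · exact (aestronglyMeasurable_convolution hG.1 hg.1).congr hu.ae_eq_besselConv.symm
  · rw [eLpNorm_congr_ae hu.ae_eq_besselConv]
    have := eLpNorm_convolution_le hG.1 hg.1 (by linarith) two_pos hrq hq hqr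
    rwa [ENNReal.ofReal_ofNat] at this

/-- The modulus of continuity is that of the kernel, hence common to all `u` with bounded norm. -/
theorem eLpNorm_translate_sub_le {q r : ℝ} (hr : 1 ≤ r) (hrq : r ≤ q) (hq : 2 ≤ q)
    (hqr : 1 / r + 1 / 2 = 1 + 1 / q)
    (hG : MemLp (besselKernel (N := N) α) (ENNReal.ofReal r) volume)
    (hu : MemBesselSpace α u) (h : EuclideanSpace ℝ (Fin N)) :
    eLpNorm (fun x => u (x + h) - u x) (ENNReal.ofReal q) volume ≤
      eLpNorm (fun x => besselKernel (N := N) α (x + h) - besselKernel α x)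
        (ENNReal.ofReal r) volume * eLpNorm (besselOperator α u) 2 volume := by
  have hg := hu.memLp_besselOperator
  have hg2 : MemLp (besselOperator α u) (ENNReal.ofReal 2) volume := by
    rwa [ENNReal.ofReal_ofNat]
  have hue := hu.ae_eq_besselConv
  have hueh : ∀ᵐ x, u (x + h) = besselConv α (besselOperator α u) (x + h) :=
    (measurePreserving_add_right volume h).quasiMeasurePreserving.ae hue
  have e : (fun x => u (x + h) - u x) =ᵐ[volume] fun x =>
      besselConv α (besselOperator α u) (x + h) - besselConv α (besselOperator α u) x := by
    filter_upwards [hue, hueh] with x h1 h2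
    rw [h1, h2]
  rw [eLpNorm_congr_ae e]
  have := eLpNorm_convolution_translate_sub_le hG hg2 (by linarith) two_pos hrq hq hqr h
  rwa [ENNReal.ofReal_ofNat] at this

theorem eLpNorm_two_le_of_lintegral_weight_le {c K : ℝ} (hc : 0 < c) (hK0 : 0 ≤ K)
    (hcV : ∀ᵐ x, c ≤ V x)
    (hK : ∫⁻ x, ENNReal.ofReal (V x * |u x| ^ 2) ≤ ENNReal.ofReal K) :
    eLpNorm u 2 volume ≤ ENNReal.ofReal ((c⁻¹ * K) ^ (1 / 2 : ℝ)) := by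
  have h1 : ∫⁻ x, ‖u x‖ₑ ^ (2 : ℝ) ≤ ENNReal.ofReal (c⁻¹ * K) := by
    rw [ENNReal.ofReal_mul (by positivity)]
    refine le_trans ?_ (mul_le_mul_right hK _)
    rw [← lintegral_const_mul' _ _ ENNReal.ofReal_ne_top]
    refine lintegral_mono_ae ?_
    filter_upwards [hcV] with x hx
    rw [← ENNReal.ofReal_mul (by positivity), ← ofReal_norm,
      ENNReal.ofReal_rpow_of_nonneg (norm_nonneg _) zero_le_two]
    refine ENNReal.ofReal_le_ofReal ?_
    rw [Real.rpow_two, Real.norm_eq_abs, ← mul_assoc]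
    refine le_mul_of_one_le_left (by positivity) ?_
    rw [inv_mul_eq_div, one_le_div hc]
    exact hx
  have h2 := eLpNorm_ofReal_eq_lintegral (ν := volume) u two_pos
  rw [ENNReal.ofReal_ofNat] at h2
  rw [h2, ← ENNReal.ofReal_rpow_of_nonneg (by positivity) (by norm_num)]
  exact ENNReal.rpow_le_rpow h1 (by norm_num)

theorem weightedNorm_nonneg : 0 ≤ weightedNorm α V u := Real.sqrt_nonneg _

/-- With `δ` and `K` fixed, the tail bound is `T η^(q/2)`. Taking `η` small and then `R` from (V2)
gives a radius independent of `u`. As `T` contains the inverse volume of the `δ`-ball, `R` may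
depend on `δ`. -/
theorem exists_eLpNorm_setAverage_compl_ball_le (hVm : AEMeasurable V volume)
    (hV : IsCoerciveElectricPotential V) {q δ : ℝ} (hq : 2 ≤ q) (hδ : 0 < δ) (hδ1 : δ ≤ 1)
    {K : ℝ≥0∞} (hK : K ≠ ∞) {ε : ℝ≥0∞} (hε : 0 < ε) :
    ∃ R : ℝ, ∀ u : EuclideanSpace ℝ (Fin N) → ℝ, AEMeasurable u volume →
      ∫⁻ x, ENNReal.ofReal (V x * |u x| ^ 2) ≤ K →
      eLpNorm (fun x => ⨍ y in Metric.ball x δ, u y) (ENNReal.ofReal q)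
        (volume.restrict (Metric.ball 0 R)ᶜ) ≤ ε := by
  have hq0 : 0 < q := by linarith
  set c := (volume (Metric.ball (0 : EuclideanSpace ℝ (Fin N)) δ))⁻¹ with hc
  set T := c ^ q * K ^ (q / 2) * volume (Metric.ball (0 : EuclideanSpace ℝ (Fin N)) 1) with hT
  have hTtop : T ≠ ∞ := by
    refine ENNReal.mul_ne_top (ENNReal.mul_ne_top (ENNReal.rpow_ne_top_of_nonneg hq0.le ?_)
      (ENNReal.rpow_ne_top_of_nonneg (by positivity) hK)) measure_ball_lt_top.ne
    exact ENNReal.inv_ne_top.2 (Metric.measure_ball_pos _ _ hδ).ne'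
  have hlim : Tendsto (fun η : ℝ => T * ENNReal.ofReal η ^ (q / 2)) (𝓝[>] 0) (𝓝 0) := by
    have h1 : Tendsto (fun η : ℝ => ENNReal.ofReal η ^ (q / 2)) (𝓝 0) (𝓝 0) := by
      have := ((ENNReal.continuous_rpow_const (y := q / 2)).comp
        ENNReal.continuous_ofReal).tendsto 0
      simpa [Function.comp_def, ENNReal.zero_rpow_of_pos (half_pos hq0)] using this
    simpa using (ENNReal.Tendsto.const_mul h1 (Or.inr hTtop)).mono_left nhdsWithin_le_nhds
  have hεq : 0 < ε ^ q := ENNReal.rpow_pos_of_nonneg hε hq0.le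
  obtain ⟨η, hηT, hη⟩ :=
    ((ENNReal.tendsto_nhds_zero.1 hlim _ hεq).and self_mem_nhdsWithin).exists
  obtain ⟨R, hR⟩ := hV.exists_lintegral_inv_le hVm hη
  refine ⟨R, fun u hu huK => ?_⟩
  rw [← ENNReal.rpow_le_rpow_iff hq0, ← lintegral_enorm_rpow_eq_eLpNorm _ hq0]
  refine (setLIntegral_setAverage_ball_rpow_le hVm hV.ae_pos hu hq hδ1 huK
    Metric.isOpen_ball.measurableSet.compl hR).trans (le_trans (le_of_eq ?_) hηT)
  rw [hT]; ring

end Embedding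

/-! ### The compact embedding -/

theorem proposition3p5 (N : ℕ) (α : ℝ) (hα : 0 < α) (hN : 2 * α < (N : ℝ))
    (V : EuclideanSpace ℝ (Fin N) → ℝ) (hVm : AEMeasurable V volume)
    (hV : IsCoerciveElectricPotential V)
    (q : ℝ) (hq : 2 ≤ q) (hq' : q < 2 * (N : ℝ) / ((N : ℝ) - 2 * α)) :
    IsCompactlyEmbeddedInLp (weightedSpace α V) (weightedNorm α V) (ENNReal.ofReal q) := by
  obtain ⟨r, hr, hrq, hqr, hrN⟩ := exists_young_exponent hN hq hq'
  have hG := memLp_besselKernel hα (by linarith) hr hrN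
  set G := besselKernel (N := N) α
  set Γ := eLpNorm G (ENNReal.ofReal r) volume with hΓ
  have hΓtop : Γ ≠ ∞ := hG.2.ne
  have hbound : ∀ u ∈ weightedSpace α V, eLpNorm u (ENNReal.ofReal q) volume ≤
      Γ * ENNReal.ofReal (weightedNorm α V u) := fun u hu =>
    (aestronglyMeasurable_and_eLpNorm_le_of_memBesselSpace hr hrq hq hqr hG hu.1).2.trans
      (mul_le_mul_right (eLpNorm_besselOperator_le hV hu) _)
  have hmem : ∀ u ∈ weightedSpace α V, MemLp u (ENNReal.ofReal q) volume := fun u hu =>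
    ⟨(aestronglyMeasurable_and_eLpNorm_le_of_memBesselSpace hr hrq hq hqr hG hu.1).1,
      (hbound u hu).trans_lt (ENNReal.mul_lt_top hΓtop.lt_top ENNReal.ofReal_lt_top)⟩
  refine ⟨hmem, ⟨Γ.toReal, fun u hu => ?_⟩, ?_⟩
  · rw [ENNReal.ofReal_mul ENNReal.toReal_nonneg, ENNReal.ofReal_toReal hΓtop]
    exact hbound u hu
  · rintro u hu ⟨M, hM⟩
    have hM0 : 0 ≤ M := weightedNorm_nonneg.trans (hM 0)
    obtain ⟨c, hc, hcV⟩ := hV.exists_pos_le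
    have hK (n : ℕ) : ∫⁻ x, ENNReal.ofReal (V x * |u n x| ^ 2) ≤ ENNReal.ofReal (M ^ 2) :=
      (lintegral_weight_le hV (hu n)).trans (ENNReal.ofReal_le_ofReal
        (pow_le_pow_left₀ weightedNorm_nonneg (hM n) 2))
    have hu2 (n : ℕ) := eLpNorm_two_le_of_lintegral_weight_le hc (sq_nonneg M) hcV (hK n)
    refine exists_tendsto_eLpNorm_of_equicontinuous_of_tail (by linarith)
      (fun n => hmem _ (hu n)) (fun n => ⟨(hmem _ (hu n)).1,
        (hu2 n).trans_lt ENNReal.ofReal_lt_top⟩) hu2 ?_ ?_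
    · intro ε hε
      -- Equicontinuity: `‖G(· + h) - G‖_r * M` tends to `0` with `h`, independently of `n`.
      have hlim := ENNReal.Tendsto.mul_const (tendsto_eLpNorm_translate_sub
        (p := ENNReal.ofReal r) (by simpa using hr) ENNReal.ofReal_ne_top hG)
        (Or.inr (ENNReal.ofReal_ne_top (r := M)))
      rw [zero_mul] at hlim
      obtain ⟨δ, hδ, hδε⟩ := Metric.eventually_nhds_iff.1 (ENNReal.tendsto_nhds_zero.1 hlim ε hε)
      refine ⟨δ, hδ, fun n h hh => ?_⟩
      refine (eLpNorm_translate_sub_le hr hrq hq hqr hG (hu n).1 h).trans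
        (le_trans ?_ (hδε (by simpa using hh)))
      gcongr
      exact (eLpNorm_besselOperator_le hV (hu n)).trans (ENNReal.ofReal_le_ofReal (hM n))
    · intro δ hδ hδ1 ε hε
      obtain ⟨R, hR⟩ := exists_eLpNorm_setAverage_compl_ball_le hVm hV hq hδ hδ1
        (ENNReal.ofReal_ne_top (r := M ^ 2)) hε
      exact ⟨R, fun n => hR _ (hmem _ (hu n)).1.aemeasurable (hK n)⟩
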